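/- Let $n\ge 1$, $q\in\mathbb C$ with $0<|q|<1$, and $\tau\in\mathbb T_n:=\{\tau\in\mathbb C^n : 0<|\tau_1|<\cdots<|\tau_n|<1\}$. Let $W_n=\{\pm1\}^n\rtimes S_n$ act on $\mathbb Z^n$ by signed permutations, and on Laurent polynomials in $x_1,\dots,x_n$ over $\mathbb C$ by $x^\alpha\mapsto x^{w\alpha}$; a Laurent polynomial is symmetric if it is $W_n$-invariant. Put $|\alpha|=\sum_i|\alpha_i|$ for $\alpha\in\mathbb Z^n$; a Laurent polynomial has degree $\le d$ if all monomials $x^\alpha$ occurring in it satisfy $|\alpha|\le d$. Let $\Lambda_n^+=\{\lambda\in\mathbb Z^n:\lambda_1\ge\cdots\ge\lambda_n\ge0\}$, and let $\alpha^+$ be the unique element of $\Lambda_n^+\cap W_n\alpha$. Let $\pi_\alpha\in S_n$ be the unique permutation such that, for $i<j$, $\pi_\alpha^{-1}(i)<\pi_\alpha^{-1}(j)$ if and only if $|\alpha_i|>|\alpha_j|$ or $0\le\alpha_i=\pm\alpha_j$. Define $\overline\alpha=\overline\alpha(q,\tau)\in(\mathbb C^*)^n$ by $\overline\alpha_i=q^{\alpha_i}\bigl(\tau_{\pi_\alpha^{-1}(i)}\bigr)^{\mathrm{sgn}(\alpha_i)}$,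 where $\mathrm{sgn}(a)=1$ for $a\ge0$ and $\mathrm{sgn}(a)=-1$ for $a<0$ (so $\overline\mu_i=q^{\mu_i}\tau_i$ for $\mu\in\Lambda_n^+$). For $\lambda\in\Lambda_n^+$ let $R_\lambda(x)=R_\lambda(x;q,\tau)$ be the symmetric Laurent polynomial of degree $\le|\lambda|$ with $R_\lambda(\overline\lambda)=1$ and $R_\lambda(\overline\mu)=0$ for all $\mu\in\Lambda_n^+$ with $|\mu|\le|\lambda|$, $\mu\ne\lambda$. For $\alpha\in\mathbb Z^n$ let $G_\alpha(x)=G_\alpha(x;q,\tau)$ be the Laurent polynomial of degree $\le|\alpha|$ with $G_\alpha(\overline\alpha)=1$ and $G_\alpha(\overline\beta)=0$ for all $\beta\in\mathbb Z^n$ with $|\beta|\le|\alpha|$, $\beta\ne\alpha$. **Theorem.** The Laurent polynomials $R_\lambda$ and $G_\alpha$ exist and are unique, and: (a) $R_\lambda(\overline\alpha)=R_\lambda(\overline{\alpha^+})$ for all $\lambda\in\Lambda_n^+$ and $\alpha\in\mathbb Z^n$. (b) For all $\lambda\in\Lambda_n^+$, $\displaystyle R_\lambda(x)=\sum_{\beta\in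 W_n\lambda}G_\beta(x).$ (c) (Principal specialization.) Let $s,t\in\mathbb C$ with $0<|s|<1$ and, if $n>1$, $0<|t|<1$, and put $\tau_i=st^{n-i}$. Then $\tau\in\mathbb T_n$, and with $R_\lambda(x;q,s,t)$ and $G_\beta(x;q,s,t)$ denoting $R_\lambda$ and $G_\beta$ for this $\tau$, $$R_\lambda(x;q,s,t)=\sum_{\beta\in W_n\lambda}G_\beta(x;q,s,t)\qquad(\lambda\in\Lambda_n^+).$$ Let $P^*_\lambda$ be Okounkov's $BC$-type interpolation Macdonald polynomial up to normalization, that is, a Laurent polynomial of degree $\le|\lambda|$ such that $P^*_\lambda(x_1/\tau_1,\dots,x_n/\tau_n)$ is symmetric, $P^*_\lambda(q^{\lambda_1},\dots,q^{\lambda_n})\ne0$, and $P^*_\lambda(q^{\mu_1},\dots,q^{\mu_n})=0$ for all $\mu\in\Lambda_n^+$ with $|\mu|\le|\lambda|$, $\mu\neq\lambda$. Such a $P^*_\lambda$ exists, and every such $P^*_\lambda$ satisfies $$P^*_\lambda(x_1/\tau_1,\dots,x_n/\tau_n)=P^*_\lambda(q^{\lambda_1},\dots,q^{\lambda_n})\sum_{\beta\in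 W_n\lambda}G_\beta(x;q,s,t).$$ -/

import Mathlib

noncomputable section

namespace BCInterp

/-! ## Laurent polynomials in `n` variables over `ℂ` -/

/-- Laurent polynomials in `n` variables with complex coefficients: the group algebra
of `ℤⁿ`. The coefficient of the monomial `x^α` in `f` is `f.coeff α`. -/
abbrev Laurent (n : ℕ) : Type := AddMonoidAlgebra ℂ (Fin n → ℤ)

/-- The value at `x` of the monomial `x^α`. -/
def monomialAt {n : ℕ} (x : Fin n → ℂ) (α : Fin n → ℤ) : ℂ := ∏ i, x i ^ α i

/-- The value of a Laurent polynomial at a point `x` (with nonzero coordinates). -/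
def evalAt {n : ℕ} (x : Fin n → ℂ) (f : Laurent n) : ℂ :=
  f.coeff.sum fun α c => c * monomialAt x α

/-- The Laurent polynomial `f(c₁ x₁, …, cₙ xₙ)`. -/
def rescale {n : ℕ} (c : Fin n → ℂ) (f : Laurent n) : Laurent n :=
  f.coeff.sum fun α a => AddMonoidAlgebra.single α (a * monomialAt c α)

/-- The weight `|α| = |α₁| + ⋯ + |αₙ|`. -/
def weight {n : ℕ} (α : Fin n → ℤ) : ℕ := ∑ i, (α i).natAbs

/-- `f` has degree at most `d`: every monomial that occurs in `f` has weight at most `d`. -/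
def DegreeLE {n : ℕ} (d : ℕ) (f : Laurent n) : Prop :=
  ∀ α : Fin n → ℤ, f.coeff α ≠ 0 → weight α ≤ d

/-! ## The hyperoctahedral group -/

/-- The action of `Sₙ` on `{±1}ⁿ` by permutation of the coordinates. -/
def permSigns (n : ℕ) : Equiv.Perm (Fin n) →* MulAut (Fin n → ℤˣ) where
  toFun p :=
    { toFun := fun σ j => σ (p.symm j)
      invFun := fun σ j => σ (p j)
      left_inv := fun σ => by funext j; simp
      right_inv := fun σ => by funext j; simp
      map_mul' := fun _ _ => rfl }
  map_one' := rfl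
  map_mul' _ _ := rfl

/-- The Weyl group `Wₙ = {±1}ⁿ ⋊ Sₙ` of type `Bₙ`. -/
abbrev WeylB (n : ℕ) : Type := (Fin n → ℤˣ) ⋊[permSigns n] Equiv.Perm (Fin n)

/-- `Wₙ` acts on `ℤⁿ` by signed permutations: `(σπ α)_j = σ_j α_{π⁻¹(j)}`. -/
instance weylAction (n : ℕ) : MulAction (WeylB n) (Fin n → ℤ) where
  smul w α := fun j => (w.left j : ℤ) * α (w.right.symm j)
  one_smul α := by
    funext j
    change (((1 : Fin n → ℤˣ) j : ℤˣ) : ℤ) * α j = α j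
    simp
  mul_smul v w α := by
    funext j
    change ((v.left j * w.left (v.right.symm j) : ℤˣ) : ℤ) * α (w.right.symm (v.right.symm j))
      = (v.left j : ℤ) * ((w.left (v.right.symm j) : ℤ) * α (w.right.symm (v.right.symm j)))
    rw [Units.val_mul, mul_assoc]

theorem weyl_smul_apply {n : ℕ} (w : WeylB n) (α : Fin n → ℤ) (j : Fin n) :
    (w • α) j = (w.left j : ℤ) * α (w.right.symm j) := rfl

/-- `f` is symmetric: it is invariant under the action of `Wₙ` on Laurent polynomials
that sends `x^α` to `x^{wα}`. -/
def IsSymmetric {n : ℕ} (f : Laurent n) : Prop :=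
  ∀ w : WeylB n, AddMonoidAlgebra.mapDomain (fun α : Fin n → ℤ => w • α) f = f

theorem finite_weyl (n : ℕ) : Finite (WeylB n) :=
  Finite.of_equiv _ (SemidirectProduct.equivProd (φ := permSigns n)).symm

theorem finite_orbit {n : ℕ} (α : Fin n → ℤ) : (MulAction.orbit (WeylB n) α).Finite := by
  have := finite_weyl n
  exact Set.finite_range _

/-- The orbit `Wₙ α` as a finite set. -/
def orbitFinset {n : ℕ} (α : Fin n → ℤ) : Finset (Fin n → ℤ) := (finite_orbit α).toFinset

/-- Partitions of length at most `n`: `λ₁ ≥ ⋯ ≥ λₙ ≥ 0`. -/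
def IsPartition {n : ℕ} (lam : Fin n → ℤ) : Prop := Antitone lam ∧ ∀ i, 0 ≤ lam i

/-! ## The permutation `π_α` and the dominant representative `α⁺` -/

/-- The indices `1, …, n` are ordered by decreasing `|α_i|`; among equal absolute values
the nonnegative entries come first, with increasing index, followed by the
negative entries, with decreasing index. -/
def sortKey {n : ℕ} (α : Fin n → ℤ) (i : Fin n) : ℤ ×ₗ ℤ :=
  toLex (-|α i|, if 0 ≤ α i then (i : ℤ) else 2 * n - i)

/-- The permutation `π_α` that lists the indices in the order given by `sortKey`. -/
def sortPerm {n : ℕ} (α : Fin n → ℤ) : Equiv.Perm (Fin n) := Tuple.sort (sortKey α)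

/-- The partition `α⁺` in the orbit `Wₙ α`. -/
def domRep {n : ℕ} (α : Fin n → ℤ) : Fin n → ℤ := fun j => |α (sortPerm α j)|

theorem sortKey_injective {n : ℕ} (α : Fin n → ℤ) : Function.Injective (sortKey α) := by
  intro i j h
  have h' := toLex.injective h
  simp only [Prod.mk.injEq] at h'
  obtain ⟨_, h2⟩ := h'
  have hi := i.isLt
  have hj := j.isLt
  apply Fin.ext
  split_ifs at h2 <;> omega

/-- The property that characterizes `π_α`. -/
theorem sortPerm_symm_lt_iff {n : ℕ} (α : Fin n → ℤ) {i j : Fin n} (hij : i < j) :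
    (sortPerm α).symm i < (sortPerm α).symm j ↔
      |α j| < |α i| ∨ (0 ≤ α i ∧ (α i = α j ∨ α i = -α j)) := by
  have hmono : StrictMono (sortKey α ∘ sortPerm α) :=
    (Tuple.monotone_sort (sortKey α)).strictMono_of_injective
      ((sortKey_injective α).comp (sortPerm α).injective)
  rw [← hmono.lt_iff_lt]
  simp only [Function.comp_apply, Equiv.apply_symm_apply, sortKey, Prod.Lex.toLex_lt_toLex]
  have hi := i.isLt
  have hj := j.isLt
  have hij' : (i : ℕ) < j := hij
  rcases abs_cases (α i) with ⟨h1, h2⟩ | ⟨h1, h2⟩ <;>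
    rcases abs_cases (α j) with ⟨h3, h4⟩ | ⟨h3, h4⟩ <;>
    rw [h1, h3] <;> split_ifs <;> omega

theorem isPartition_domRep {n : ℕ} (α : Fin n → ℤ) : IsPartition (domRep α) := by
  refine ⟨fun i j hij => ?_, fun i => abs_nonneg _⟩
  have h : sortKey α (sortPerm α i) ≤ sortKey α (sortPerm α j) :=
    Tuple.monotone_sort (sortKey α) hij
  simp only [sortKey, Prod.Lex.toLex_le_toLex] at h
  simp only [domRep]
  omega

theorem domRep_mem_orbit {n : ℕ} (α : Fin n → ℤ) : domRep α ∈ MulAction.orbit (WeylB n) α := by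
  refine ⟨⟨fun j => if 0 ≤ α (sortPerm α j) then 1 else -1, (sortPerm α).symm⟩, ?_⟩
  funext j
  change ((if 0 ≤ α (sortPerm α j) then (1 : ℤˣ) else -1 : ℤˣ) : ℤ) * α (sortPerm α j) = _
  simp only [domRep]
  split_ifs with h
  · simp [abs_of_nonneg h]
  · simp [abs_of_neg (not_le.mp h)]

theorem eq_domRep_of_mem_orbit {n : ℕ} (α μ : Fin n → ℤ) (hμ : IsPartition μ)
    (h : μ ∈ MulAction.orbit (WeylB n) α) : μ = domRep α := by
  obtain ⟨w, rfl⟩ := h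
  have key : (w • α) = (fun i => |α i|) ∘ w.right.symm := by
    funext j
    have h0 : 0 ≤ (w • α) j := hμ.2 j
    rw [Function.comp_apply, ← abs_of_nonneg h0]
    change |(w.left j : ℤ) * α (w.right.symm j)| = _
    rcases Int.units_eq_one_or (w.left j) with hw | hw <;> simp [hw]
  have h1 : Antitone ((fun i => |α i|) ∘ w.right.symm) := key ▸ hμ.1
  have h2 : Antitone ((fun i => |α i|) ∘ sortPerm α) := (isPartition_domRep α).1
  exact key.trans (Tuple.unique_antitone h1 h2)

/-! ## Interpolation points -/

/-- The parameters `τ` with `0 < |τ₁| < ⋯ < |τₙ| < 1`. -/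
def paramSet (n : ℕ) : Set (Fin n → ℂ) :=
  {τ | (∀ i, 0 < ‖τ i‖) ∧ StrictMono (fun i => ‖τ i‖) ∧ ∀ i, ‖τ i‖ < 1}

/-- The interpolation point of `α`: its `i`-th coordinate is
`q^{α_i} (τ_{π_α⁻¹(i)})^{sgn(α_i)}`, with `sgn(a) = 1` if `a ≥ 0` and `sgn(a) = -1` if `a < 0`. -/
def interpPoint {n : ℕ} (q : ℂ) (τ : Fin n → ℂ) (α : Fin n → ℤ) : Fin n → ℂ := fun i =>
  q ^ α i * τ ((sortPerm α).symm i) ^ (if 0 ≤ α i then (1 : ℤ) else -1)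

theorem interpPoint_of_isPartition {n : ℕ} (q : ℂ) (τ : Fin n → ℂ) {μ : Fin n → ℤ}
    (hμ : IsPartition μ) (i : Fin n) : interpPoint q τ μ i = q ^ μ i * τ i := by
  have h : sortPerm μ = Equiv.refl _ := by
    refine Tuple.sort_eq_refl_iff_monotone.mpr fun a b hab => ?_
    have h1 := hμ.1 hab
    have h2 := hμ.2 a
    have h3 := hμ.2 b
    have hab' : (a : ℕ) ≤ b := hab
    simp only [sortKey, Prod.Lex.toLex_le_toLex, abs_of_nonneg h2, abs_of_nonneg h3,
      if_pos h2, if_pos h3]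
    omega
  simp [interpPoint, h, if_pos (hμ.2 i)]

/-! ## Interpolation Laurent polynomials -/

/-- The defining properties of the symmetric interpolation Laurent polynomial of a
partition `lam`. -/
def IsSymInterp {n : ℕ} (q : ℂ) (τ : Fin n → ℂ) (lam : Fin n → ℤ) (f : Laurent n) : Prop :=
  IsSymmetric f ∧ DegreeLE (weight lam) f ∧ evalAt (interpPoint q τ lam) f = 1 ∧
    ∀ μ : Fin n → ℤ, IsPartition μ → weight μ ≤ weight lam → μ ≠ lam →
      evalAt (interpPoint q τ μ) f = 0

/-- The defining properties of the nonsymmetric interpolation Laurent polynomial of `α ∈ ℤⁿ`. -/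
def IsNonsymInterp {n : ℕ} (q : ℂ) (τ : Fin n → ℂ) (α : Fin n → ℤ) (g : Laurent n) : Prop :=
  DegreeLE (weight α) g ∧ evalAt (interpPoint q τ α) g = 1 ∧
    ∀ β : Fin n → ℤ, weight β ≤ weight α → β ≠ α → evalAt (interpPoint q τ β) g = 0

/-- The symmetric interpolation Laurent polynomial `R_lam(x; q, τ)`. -/
def symInterp {n : ℕ} (q : ℂ) (τ : Fin n → ℂ) (lam : Fin n → ℤ) : Laurent n :=
  Classical.epsilon (IsSymInterp q τ lam)

/-- The nonsymmetric interpolation Laurent polynomial `G_α(x; q, τ)`. -/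
def nonsymInterp {n : ℕ} (q : ℂ) (τ : Fin n → ℂ) (α : Fin n → ℤ) : Laurent n :=
  Classical.epsilon (IsNonsymInterp q τ α)

/-! ## The principal specialization -/

/-- The principal specialization `τ_i = s t^{n-i}`, `i = 1, …, n` (indices in `Fin n`
start at `0`). -/
def principalSpec (n : ℕ) (s t : ℂ) : Fin n → ℂ := fun i => s * t ^ (n - 1 - (i : ℕ))

/-- `P` is a `BC`-type interpolation Macdonald polynomial of the partition `lam`, in
Okounkov's variables and up to normalization: `P` has degree at most `|lam|`, it becomes symmetric
when it is written in the variables `s t^{n-i} x_i`, and it vanishes at `q^μ` for all partitions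
`μ ≠ lam` with `|μ| ≤ |lam|`, but not at `q^lam`. -/
def IsOkounkov {n : ℕ} (q s t : ℂ) (lam : Fin n → ℤ) (P : Laurent n) : Prop :=
  DegreeLE (weight lam) P ∧
    IsSymmetric (rescale (fun i => (principalSpec n s t i)⁻¹) P) ∧
    evalAt (fun i => q ^ lam i) P ≠ 0 ∧
    ∀ μ : Fin n → ℤ, IsPartition μ → weight μ ≤ weight lam → μ ≠ lam →
      evalAt (fun i => q ^ μ i) P = 0

end BCInterp

end

open BCInterp

noncomputable section

namespace BCInterp

open scoped Pointwise

/-!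
Enumerate the integers as `0, -1, 1, -2, 2, …` and, accordingly, the pairs `(i, b)` of an index and
an integer in decreasing order of the key that `sortKey` gives to an entry `b` in position `i`. The
Newton polynomial of `α` is the product, over all `i` and all `b` preceding `α i`, of the factors
`x_i ^ sgn b - q ^ |b| * τ_k`, where `k` is the place that the pair `(i, b)` would get among the
sorted entries of `α`. If the earliest pair at which `α` and `β` differ belongs to `β`, then one of
these factors vanishes at the interpolation point of `β`. So evaluation of the Newton polynomials
at the interpolation points is triangular, which makes interpolation in each degree uniquely
solvable. The point of `α` arises from that of `α⁺` by permuting and inverting coordinates, so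
symmetric Laurent polynomials are determined by their values at the points of partitions, and
`R_λ` and the sum of the `G_β` over the orbit of `λ` take the same values at all
interpolation points.
-/

/-- `(q, τ)` is nonresonant if `q` and the `τ_i` are nonzero and, for `m ≥ 1` and `i ≤ j`,
`q ^ m * τ_i ≠ τ_j` and `q ^ m * τ_i * τ_j ≠ 1`. This is what interpolation at the points
`interpPoint q τ α` requires of the parameters. -/
structure IsNonresonant {n : ℕ} (q : ℂ) (τ : Fin n → ℂ) : Prop where
  base_ne_zero : q ≠ 0
  param_ne_zero (i : Fin n) : τ i ≠ 0
  pow_mul_ne {i j : Fin n} {m : ℕ} (hij : i ≤ j) (hm : m ≠ 0) : q ^ m * τ i ≠ τ j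
  pow_mul_mul_ne_one {i j : Fin n} {m : ℕ} (hij : i ≤ j) (hm : m ≠ 0) : q ^ m * (τ i * τ j) ≠ 1

theorem isNonresonant_of_mem_paramSet {n : ℕ} {q : ℂ} {τ : Fin n → ℂ} (hq0 : 0 < ‖q‖)
    (hq1 : ‖q‖ < 1) (hτ : τ ∈ paramSet n) : IsNonresonant q τ := by
  obtain ⟨hpos, hmono, hlt⟩ := hτ
  have hpow {m : ℕ} (hm : m ≠ 0) : ‖q‖ ^ m < 1 := pow_lt_one₀ hq0.le hq1 hm
  refine ⟨norm_pos_iff.mp hq0, fun i => norm_pos_iff.mp (hpos i), fun {i j m} hij hm h => ?_,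
    fun {i j m} _ hm h => ?_⟩
  · have hnorm : ‖q‖ ^ m * ‖τ i‖ < ‖τ j‖ :=
      (mul_lt_of_lt_one_left (hpos i) (hpow hm)).trans_le (hmono.monotone hij)
    exact hnorm.ne (by rw [← h, norm_mul, norm_pow])
  · have hnorm : ‖q‖ ^ m * (‖τ i‖ * ‖τ j‖) < 1 :=
      mul_lt_one_of_nonneg_of_lt_one_left (pow_nonneg hq0.le m) (hpow hm)
        (mul_le_one₀ (hlt i).le (hpos j).le (hlt j).le)
    exact hnorm.ne (by rw [← norm_mul, ← norm_pow, ← norm_mul, h, norm_one])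

theorem principalSpec_mem_paramSet {n : ℕ} {s t : ℂ} (hs0 : 0 < ‖s‖) (hs1 : ‖s‖ < 1)
    (ht : 1 < n → 0 < ‖t‖ ∧ ‖t‖ < 1) : principalSpec n s t ∈ paramSet n := by
  have hnorm (i : Fin n) : ‖principalSpec n s t i‖ = ‖s‖ * ‖t‖ ^ (n - 1 - (i : ℕ)) := by
    rw [principalSpec, norm_mul, norm_pow]
  have hpow (i : Fin n) : 0 < ‖t‖ ^ (n - 1 - (i : ℕ)) ∧ ‖t‖ ^ (n - 1 - (i : ℕ)) ≤ 1 := by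
    by_cases hi : n - 1 - (i : ℕ) = 0
    · simp [hi]
    · obtain ⟨ht0, ht1⟩ := ht (by omega)
      exact ⟨pow_pos ht0 _, pow_le_one₀ ht0.le ht1.le⟩
  refine ⟨fun i => ?_, fun i j hij => ?_, fun i => ?_⟩
  · rw [hnorm]
    exact mul_pos hs0 (hpow i).1
  · obtain ⟨ht0, ht1⟩ := ht (by omega)
    simp only [hnorm]
    exact mul_lt_mul_of_pos_left (pow_lt_pow_right_of_lt_one₀ ht0 ht1 (by omega)) hs0
  · rw [hnorm]
    exact (mul_le_of_le_one_right hs0.le (hpow i).2).trans_lt hs1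

/-! ## Evaluation and rescaling -/

section Evaluation

variable {n : ℕ}

theorem monomialAt_zero (x : Fin n → ℂ) : monomialAt x 0 = 1 := by
  simp [monomialAt]

theorem monomialAt_add {x : Fin n → ℂ} (hx : ∀ i, x i ≠ 0) (α β : Fin n → ℤ) :
    monomialAt x (α + β) = monomialAt x α * monomialAt x β := by
  simp only [monomialAt, Pi.add_apply, ← Finset.prod_mul_distrib]
  exact Finset.prod_congr rfl fun i _ => zpow_add₀ (hx i) _ _

theorem monomialAt_single (x : Fin n → ℂ) (i : Fin n) (k : ℤ) :
    monomialAt x (Pi.single i k) = x i ^ k := by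
  rw [monomialAt, Fintype.prod_eq_single i fun j hj => by rw [Pi.single_eq_of_ne hj, zpow_zero],
    Pi.single_eq_same]

theorem monomialAt_mul (x y : Fin n → ℂ) (α : Fin n → ℤ) :
    monomialAt (fun i => x i * y i) α = monomialAt x α * monomialAt y α := by
  simp only [monomialAt, mul_zpow, Finset.prod_mul_distrib]

/-- Evaluation at `x` as a linear map. -/
def evalLinear (x : Fin n → ℂ) : Laurent n →ₗ[ℂ] ℂ :=
  Finsupp.linearCombination ℂ (monomialAt x) ∘ₗ
    (AddMonoidAlgebra.coeffLinearEquiv ℂ).toLinearMap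

theorem evalAt_single (x : Fin n → ℂ) (α : Fin n → ℤ) (c : ℂ) :
    evalAt x (AddMonoidAlgebra.single α c) = c * monomialAt x α := by
  simp [evalAt]

theorem evalAt_sum {ι : Type*} (x : Fin n → ℂ) (s : Finset ι) (f : ι → Laurent n) :
    evalAt x (∑ i ∈ s, f i) = ∑ i ∈ s, evalAt x (f i) :=
  map_sum (evalLinear x) f s

theorem evalAt_smul (x : Fin n → ℂ) (c : ℂ) (f : Laurent n) :
    evalAt x (c • f) = c * evalAt x f :=
  map_smul (evalLinear x) c f

theorem evalAt_sub (x : Fin n → ℂ) (f g : Laurent n) :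
    evalAt x (f - g) = evalAt x f - evalAt x g :=
  map_sub (evalLinear x) f g

theorem evalAt_mapDomain (x : Fin n → ℂ) (φ : (Fin n → ℤ) → Fin n → ℤ) (f : Laurent n) :
    evalAt x (AddMonoidAlgebra.mapDomain φ f) = f.coeff.sum fun α c => c * monomialAt x (φ α) :=
  Finsupp.sum_mapDomain_index (by simp) fun _ _ _ => add_mul _ _ _

/-- Evaluation as an algebra homomorphism. The coordinates of `x` have to be nonzero, since
otherwise `x_i * x_i⁻¹` is evaluated to `0`. -/
def evalAlgHom (x : Fin n → ℂ) (hx : ∀ i, x i ≠ 0) : Laurent n →ₐ[ℂ] ℂ :=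
  AddMonoidAlgebra.lift ℂ ℂ (Fin n → ℤ)
    { toFun := fun α => monomialAt x α.toAdd
      map_one' := monomialAt_zero x
      map_mul' := fun α β => monomialAt_add hx α.toAdd β.toAdd }

theorem evalAlgHom_apply (x : Fin n → ℂ) (hx : ∀ i, x i ≠ 0) (f : Laurent n) :
    evalAlgHom x hx f = evalAt x f := by
  rw [evalAlgHom, AddMonoidAlgebra.lift_apply]
  rfl

theorem evalAt_prod {ι : Type*} {x : Fin n → ℂ} (hx : ∀ i, x i ≠ 0) (s : Finset ι)
    (f : ι → Laurent n) : evalAt x (∏ i ∈ s, f i) = ∏ i ∈ s, evalAt x (f i) := by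
  simp only [← evalAlgHom_apply x hx, map_prod]

theorem coeff_rescale (c : Fin n → ℂ) (f : Laurent n) (α : Fin n → ℤ) :
    (rescale c f).coeff α = f.coeff α * monomialAt c α := by
  classical
  rw [rescale, AddMonoidAlgebra.coeff_finsuppSum, Finsupp.sum_apply]
  simp only [AddMonoidAlgebra.coeff_single, Finsupp.single_apply]
  rw [Finsupp.sum, Finset.sum_ite_eq']
  split_ifs with h
  · rfl
  · rw [Finsupp.notMem_support_iff.mp h, zero_mul]

theorem evalAt_rescale (x c : Fin n → ℂ) (f : Laurent n) :
    evalAt x (rescale c f) = evalAt (fun i => c i * x i) f := by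
  rw [rescale, Finsupp.sum, evalAt_sum, evalAt, Finsupp.sum]
  simp only [evalAt_single, monomialAt_mul, mul_assoc]

theorem rescale_inv_rescale {c : Fin n → ℂ} (hc : ∀ i, c i ≠ 0) (f : Laurent n) :
    rescale (fun i => (c i)⁻¹) (rescale c f) = f := by
  refine AddMonoidAlgebra.ext (Finsupp.ext fun α => ?_)
  rw [coeff_rescale, coeff_rescale, mul_assoc, ← monomialAt_mul]
  simp [hc, monomialAt]

end Evaluation

/-! ## Degree -/

theorem mul_mem_supported {R M : Type*} [CommSemiring R] [AddMonoid M] {S T : Set M}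
    {f g : AddMonoidAlgebra R M} (hf : f ∈ AddMonoidAlgebra.supported R R S)
    (hg : g ∈ AddMonoidAlgebra.supported R R T) :
    f * g ∈ AddMonoidAlgebra.supported R R (S + T) := by
  classical
  intro α hα
  obtain ⟨β, hβ, γ, hγ, rfl⟩ :=
    Finset.mem_add.mp (AddMonoidAlgebra.support_coeff_mul_subset f g hα)
  exact Set.add_mem_add (hf hβ) (hg hγ)

theorem prod_mem_supported {R M ι : Type*} [CommSemiring R] [AddCommMonoid M] (s : Finset ι)
    {S : ι → Set M} {f : ι → AddMonoidAlgebra R M}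
    (h : ∀ i ∈ s, f i ∈ AddMonoidAlgebra.supported R R (S i)) :
    ∏ i ∈ s, f i ∈ AddMonoidAlgebra.supported R R (∑ i ∈ s, S i) := by
  classical
  induction s using Finset.induction_on with
  | empty =>
    rw [Finset.prod_empty, Finset.sum_empty, AddMonoidAlgebra.one_def]
    exact Finsupp.single_mem_supported R 1 (Set.mem_zero.mpr rfl)
  | insert i s hi ih =>
    rw [Finset.prod_insert hi, Finset.sum_insert hi]
    exact mul_mem_supported (h i (Finset.mem_insert_self i s))
      (ih fun j hj => h j (Finset.mem_insert_of_mem hj))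

section Degree

variable {n : ℕ}

/-- The space of Laurent polynomials of degree at most `d`. -/
def degreeLE (n d : ℕ) : Submodule ℂ (Laurent n) :=
  AddMonoidAlgebra.supported ℂ ℂ {α | weight α ≤ d}

theorem mem_degreeLE {d : ℕ} {f : Laurent n} : f ∈ degreeLE n d ↔ DegreeLE d f := by
  simp [degreeLE, AddMonoidAlgebra.mem_supported, DegreeLE, Set.subset_def]

theorem single_mem_degreeLE (α : Fin n → ℤ) (c : ℂ) :
    AddMonoidAlgebra.single α c ∈ degreeLE n (weight α) :=
  Finsupp.single_mem_supported ℂ c (le_refl (weight α))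

theorem degreeLE_mono {d e : ℕ} (h : d ≤ e) : degreeLE n d ≤ degreeLE n e :=
  AddMonoidAlgebra.supported_mono fun _ hα => le_trans hα h

theorem DegreeLE.rescale {d : ℕ} {f : Laurent n} (hf : DegreeLE d f) (c : Fin n → ℂ) :
    DegreeLE d (rescale c f) := fun α hα =>
  hf α fun h => hα (by rw [coeff_rescale, h, zero_mul])

instance finite_weight_le (n d : ℕ) : Finite {α : Fin n → ℤ // weight α ≤ d} := by
  refine (Set.finite_Icc (fun _ => -(d : ℤ)) fun _ => (d : ℤ)).subset fun α hα => ?_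
  have hle (i : Fin n) : |α i| ≤ d := by
    rw [Int.abs_eq_natAbs]
    exact_mod_cast (Finset.single_le_sum (f := fun i => (α i).natAbs) (fun _ _ => Nat.zero_le _)
      (Finset.mem_univ i)).trans hα
  exact ⟨fun i => (abs_le.mp (hle i)).1, fun i => (abs_le.mp (hle i)).2⟩

end Degree

/-! ## Newton polynomials -/

section Newton

variable {n : ℕ} {q : ℂ} {τ : Fin n → ℂ}

/-- The sign of an integer, with the convention `sgn 0 = 1`. -/
def sgn (a : ℤ) : ℤˣ := if 0 ≤ a then 1 else -1

theorem interpPoint_apply (q : ℂ) (τ : Fin n → ℂ) (α : Fin n → ℤ) (i : Fin n) :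
    interpPoint q τ α i = (q ^ (α i).natAbs * τ ((sortPerm α).symm i)) ^ (sgn (α i) : ℤ) := by
  rw [interpPoint, sgn]
  split_ifs with h
  · rw [Units.val_one, zpow_one, zpow_one, ← zpow_natCast, Int.natAbs_of_nonneg h]
  · rw [Units.val_neg, Units.val_one, zpow_neg_one, zpow_neg_one, mul_inv, ← zpow_natCast,
      ← zpow_neg]
    congr 2
    omega

theorem interpPoint_zpow_sgn (q : ℂ) (τ : Fin n → ℂ) (α : Fin n → ℤ) (i : Fin n) :
    interpPoint q τ α i ^ (sgn (α i) : ℤ) = q ^ (α i).natAbs * τ ((sortPerm α).symm i) := by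
  rw [interpPoint_apply, ← zpow_mul, ← Units.val_mul, Int.units_mul_self, Units.val_one, zpow_one]

theorem interpPoint_ne_zero (h : IsNonresonant q τ) (α : Fin n → ℤ) (i : Fin n) :
    interpPoint q τ α i ≠ 0 :=
  mul_ne_zero (zpow_ne_zero _ h.base_ne_zero) (zpow_ne_zero _ (h.param_ne_zero _))

/-- The sort key of an entry `a` in position `i`, so that `sortKey α i = entryKey i (α i)`. -/
def entryKey (i : Fin n) (a : ℤ) : ℤ ×ₗ ℤ :=
  toLex (-|a|, if 0 ≤ a then (i : ℤ) else 2 * n - i)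

theorem sortKey_eq_entryKey (α : Fin n → ℤ) (i : Fin n) : sortKey α i = entryKey i (α i) := rfl

theorem entryKey_inj {i j : Fin n} {a b : ℤ} : entryKey i a = entryKey j b ↔ i = j ∧ a = b := by
  refine ⟨fun h => ?_, fun ⟨hij, hab⟩ => by rw [hij, hab]⟩
  have h' := toLex.injective h
  simp only [Prod.mk.injEq] at h'
  obtain ⟨habs, hpos⟩ := h'
  rw [Int.abs_eq_natAbs, Int.abs_eq_natAbs] at habs
  rw [Fin.ext_iff]
  split_ifs at hpos <;> omega

/-- The set of sort keys of `α`. In the colexicographic order these sets are compared at the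
largest key, i.e. at the earliest entry, in which they differ. -/
def keySet (α : Fin n → ℤ) : Finset (ℤ ×ₗ ℤ) := Finset.univ.image (sortKey α)

theorem mem_keySet {α : Fin n → ℤ} {κ : ℤ ×ₗ ℤ} : κ ∈ keySet α ↔ ∃ i, entryKey i (α i) = κ := by
  simp [keySet, sortKey_eq_entryKey]

theorem keySet_injective : Function.Injective (keySet (n := n)) := by
  intro α β h
  funext i
  obtain ⟨j, hj⟩ := mem_keySet.mp (h ▸ mem_keySet.mpr ⟨i, rfl⟩ : entryKey i (α i) ∈ keySet β)
  obtain ⟨rfl, hval⟩ := entryKey_inj.mp hj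
  exact hval.symm

/-- The integers that precede `a` in the enumeration `0, -1, 1, -2, 2, …`. -/
def preceding (a : ℤ) : Finset ℤ := if 0 ≤ a then Finset.Ico (-a) a else Finset.Ioo a (-a)

theorem mem_preceding {a b : ℤ} :
    b ∈ preceding a ↔ b.natAbs < a.natAbs ∨ b.natAbs = a.natAbs ∧ b < 0 ∧ 0 ≤ a := by
  rw [preceding]
  split_ifs
  · rw [Finset.mem_Ico]
    omega
  · rw [Finset.mem_Ioo]
    omega

theorem entryKey_lt_entryKey {i : Fin n} {a b : ℤ} :
    entryKey i a < entryKey i b ↔ b ∈ preceding a := by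
  simp only [entryKey, mem_preceding, Prod.Lex.toLex_lt_toLex, Int.abs_eq_natAbs]
  split_ifs <;> omega

/-- The place that an entry `b` in position `i` would get among the sorted entries of `α`; the
subtraction is truncated only if all entries of `α` come before it. -/
def newtonIndex (α : Fin n → ℤ) (i : Fin n) (b : ℤ) : Fin n :=
  ⟨n - 1 - Finset.card {κ ∈ keySet α | entryKey i b < κ}, by have := i.isLt; omega⟩

theorem newtonIndex_self (α : Fin n → ℤ) (i : Fin n) :
    newtonIndex α i (α i) = (sortPerm α).symm i := by
  have hmono : StrictMono (sortKey α ∘ sortPerm α) :=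
    (Tuple.monotone_sort (sortKey α)).strictMono_of_injective
      ((sortKey_injective α).comp (sortPerm α).injective)
  have habove : {κ ∈ keySet α | entryKey i (α i) < κ} =
      (Finset.Ioi ((sortPerm α).symm i)).image (sortKey α ∘ sortPerm α) := by
    have hkey : entryKey i (α i) = (sortKey α ∘ sortPerm α) ((sortPerm α).symm i) := by
      rw [Function.comp_apply, Equiv.apply_symm_apply, sortKey_eq_entryKey]
    have hset : keySet α = Finset.univ.image (sortKey α ∘ sortPerm α) := by
      rw [← Finset.image_image, Finset.image_univ_equiv, keySet]
    rw [hkey, hset, Finset.filter_image]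
    congr 1
    ext j
    simp only [Finset.mem_filter_univ, Finset.mem_Ioi, hmono.lt_iff_lt]
  simp only [Fin.ext_iff, newtonIndex, habove, Finset.card_image_of_injective _ hmono.injective,
    Fin.card_Ioi]
  omega

theorem newtonIndex_mono (α : Fin n → ℤ) {i : Fin n} {a b : ℤ}
    (h : entryKey i a ≤ entryKey i b) : newtonIndex α i a ≤ newtonIndex α i b := by
  rw [Fin.le_def]
  exact Nat.sub_le_sub_left
    (Finset.card_le_card (Finset.monotone_filter_right _ fun _ _ => h.trans_lt)) _

/-- The Newton polynomial of `α`, the product of the factors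
`x_i ^ sgn b - q ^ |b| * τ_k` over all `i` and all `b` preceding `α i`, with `k` given by
`newtonIndex`. For nonresonant parameters, the Newton polynomials of the exponents of weight at
most `d` are a basis of the Laurent polynomials of degree at most `d` adapted to the interpolation
points. -/
def newton (q : ℂ) (τ : Fin n → ℂ) (α : Fin n → ℤ) : Laurent n :=
  ∏ i, ∏ b ∈ preceding (α i), (AddMonoidAlgebra.single (Pi.single i (sgn b : ℤ)) 1 -
    AddMonoidAlgebra.single 0 (q ^ b.natAbs * τ (newtonIndex α i b)))

theorem evalAt_newton (q : ℂ) (τ : Fin n → ℂ) (α : Fin n → ℤ) {x : Fin n → ℂ}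
    (hx : ∀ i, x i ≠ 0) :
    evalAt x (newton q τ α) = ∏ i, ∏ b ∈ preceding (α i),
      (x i ^ (sgn b : ℤ) - q ^ b.natAbs * τ (newtonIndex α i b)) := by
  simp only [newton, evalAt_prod hx, evalAt_sub, evalAt_single, monomialAt_single,
    monomialAt_zero, one_mul, mul_one]

theorem card_filter_nonneg_preceding_le (a : ℤ) :
    Finset.card {b ∈ preceding a | 0 ≤ b} ≤ a.natAbs := by
  calc Finset.card {b ∈ preceding a | 0 ≤ b} ≤ (Finset.Ico 0 (a.natAbs : ℤ)).card := by
        refine Finset.card_le_card fun b hb => ?_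
        rw [Finset.mem_filter, mem_preceding] at hb
        rw [Finset.mem_Ico]
        omega
    _ = a.natAbs := by rw [Int.card_Ico]; omega

theorem card_filter_neg_preceding_le (a : ℤ) :
    Finset.card {b ∈ preceding a | b < 0} ≤ a.natAbs := by
  calc Finset.card {b ∈ preceding a | b < 0} ≤ (Finset.Ico (-a.natAbs : ℤ) 0).card := by
        refine Finset.card_le_card fun b hb => ?_
        rw [Finset.mem_filter, mem_preceding] at hb
        rw [Finset.mem_Ico]
        omega
    _ = a.natAbs := by rw [Int.card_Ico]; omega

theorem natAbs_le_of_mem_sum_sgn {a k : ℤ}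
    (hk : k ∈ ∑ b ∈ preceding a, ({(sgn b : ℤ), 0} : Set ℤ)) : k.natAbs ≤ a.natAbs := by
  obtain ⟨g, hg, rfl⟩ := (Set.mem_finsetSum _ _ _).mp hk
  have hbound (b : ℤ) (hb : b ∈ preceding a) :
      (if b < 0 then -1 else 0) ≤ g b ∧ g b ≤ if 0 ≤ b then 1 else 0 := by
    have := hg hb
    simp only [sgn, Set.mem_insert_iff, Set.mem_singleton_iff] at this
    split_ifs at this ⊢ <;> simp_all <;> omega
  have hlower := Finset.sum_le_sum (s := preceding a) fun b hb => (hbound b hb).1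
  have hupper := Finset.sum_le_sum (s := preceding a) fun b hb => (hbound b hb).2
  rw [← Finset.sum_filter, Finset.sum_const, nsmul_eq_mul] at hlower hupper
  have hneg := card_filter_neg_preceding_le a
  have hnonneg := card_filter_nonneg_preceding_le a
  omega

theorem newton_mem_degreeLE (q : ℂ) (τ : Fin n → ℂ) (α : Fin n → ℤ) :
    newton q τ α ∈ degreeLE n (weight α) := by
  have hfactor (i : Fin n) (b : ℤ) : AddMonoidAlgebra.single (Pi.single i (sgn b : ℤ)) 1 -
      AddMonoidAlgebra.single 0 (q ^ b.natAbs * τ (newtonIndex α i b)) ∈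
        AddMonoidAlgebra.supported ℂ ℂ
          (AddMonoidHom.single (fun _ => ℤ) i '' {(sgn b : ℤ), 0}) :=
    Submodule.sub_mem _ (Finsupp.single_mem_supported ℂ 1 ⟨_, Or.inl rfl, rfl⟩)
      (Finsupp.single_mem_supported ℂ _ ⟨0, Or.inr rfl, map_zero _⟩)
  have hsum : ∑ i, ∑ b ∈ preceding (α i),
      AddMonoidHom.single (fun _ => ℤ) i '' {(sgn b : ℤ), 0} ⊆ {γ | weight γ ≤ weight α} := by
    intro γ hγ
    simp only [← Set.image_finsetSum] at hγ
    obtain ⟨g, hg, rfl⟩ := (Set.mem_finsetSum _ _ _).mp hγ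
    choose k hk hkg using fun i => hg (Finset.mem_univ i)
    have hcoord (i : Fin n) : (∑ j, g j) i = k i := by
      simp [Finset.sum_apply, ← hkg]
    change ∑ i, ((∑ j, g j) i).natAbs ≤ ∑ i, (α i).natAbs
    refine Finset.sum_le_sum fun i _ => ?_
    rw [hcoord]
    exact natAbs_le_of_mem_sum_sgn (hk i)
  exact AddMonoidAlgebra.supported_mono hsum
    (prod_mem_supported _ fun i _ => prod_mem_supported _ fun b _ => hfactor i b)

theorem evalAt_newton_self_ne_zero (h : IsNonresonant q τ) (α : Fin n → ℤ) :
    evalAt (interpPoint q τ α) (newton q τ α) ≠ 0 := by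
  rw [evalAt_newton q τ α (interpPoint_ne_zero h α)]
  refine Finset.prod_ne_zero_iff.mpr fun i _ => Finset.prod_ne_zero_iff.mpr fun b hb => ?_
  have hle : (sortPerm α).symm i ≤ newtonIndex α i b :=
    newtonIndex_self α i ▸ newtonIndex_mono α (entryKey_lt_entryKey.mpr hb).le
  rw [mem_preceding] at hb
  rw [sub_ne_zero]
  intro heq
  by_cases hsgn : sgn b = sgn (α i)
  · rw [hsgn, interpPoint_zpow_sgn] at heq
    have hlt : b.natAbs < (α i).natAbs := by
      simp only [sgn] at hsgn
      split_ifs at hsgn <;> first | omega | simp at hsgn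
    rw [← Nat.add_sub_of_le hlt.le, pow_add, mul_assoc] at heq
    exact h.pow_mul_ne hle (by omega) (mul_left_cancel₀ (pow_ne_zero _ h.base_ne_zero) heq)
  · have hinv : (sgn b : ℤ) = -sgn (α i) := by
      rw [← Units.val_neg, Int.units_ne_iff_eq_neg.mp hsgn]
    rw [hinv, zpow_neg, interpPoint_zpow_sgn] at heq
    refine h.pow_mul_mul_ne_one (m := (α i).natAbs + b.natAbs) hle (by omega) ?_
    calc q ^ ((α i).natAbs + b.natAbs) *
          (τ ((sortPerm α).symm i) * τ (newtonIndex α i b))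
        = q ^ (α i).natAbs * τ ((sortPerm α).symm i) *
            (q ^ b.natAbs * τ (newtonIndex α i b)) := by ring
      _ = 1 := by
        rw [← heq, mul_inv_cancel₀]
        exact mul_ne_zero (pow_ne_zero _ h.base_ne_zero) (h.param_ne_zero _)

theorem evalAt_newton_eq_zero_of_keySet_lt (h : IsNonresonant q τ) {α β : Fin n → ℤ}
    (hlt : toColex (keySet α) < toColex (keySet β)) :
    evalAt (interpPoint q τ β) (newton q τ α) = 0 := by
  obtain ⟨κ, hκ, habove⟩ := Finset.Colex.lt_iff_exists_filter_lt.mp hlt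
  obtain ⟨hκβ, hκα⟩ := Finset.mem_sdiff.mp hκ
  obtain ⟨i, rfl⟩ := mem_keySet.mp hκβ
  have hmem : β i ∈ preceding (α i) := by
    rw [← entryKey_lt_entryKey (i := i)]
    by_contra! hle
    have hlt' := hle.lt_of_ne fun heq => hκα (mem_keySet.mpr ⟨i, heq.symm⟩)
    have hα : entryKey i (α i) ∈ {κ ∈ keySet β | entryKey i (β i) < κ} :=
      habove ▸ Finset.mem_filter.mpr ⟨mem_keySet.mpr ⟨i, rfl⟩, hlt'⟩
    obtain ⟨j, hj⟩ := mem_keySet.mp (Finset.mem_filter.mp hα).1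
    obtain ⟨rfl, hval⟩ := entryKey_inj.mp hj
    exact hlt'.ne (by rw [hval])
  have hindex : newtonIndex α i (β i) = (sortPerm β).symm i := by
    simp only [← newtonIndex_self β, newtonIndex, habove]
  rw [evalAt_newton q τ α (interpPoint_ne_zero h β)]
  refine Finset.prod_eq_zero (Finset.mem_univ i) (Finset.prod_eq_zero hmem ?_)
  rw [interpPoint_zpow_sgn, hindex, sub_self]

end Newton

/-! ## Interpolation -/

theorem isUnit_of_blockTriangular {ι α K : Type*} [Fintype ι] [DecidableEq ι] [LinearOrder α]
    [Field K] {M : Matrix ι ι K} {b : ι → α} (hb : Function.Injective b)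
    (hM : M.BlockTriangular b) (hdiag : ∀ i, M i i ≠ 0) : IsUnit M := by
  let : LinearOrder ι := LinearOrder.lift' b hb
  have htri : M.IsUpperTriangular := fun i j hij => hM hij
  rw [Matrix.isUnit_iff_isUnit_det, Matrix.det_of_isUpperTriangular htri, isUnit_iff_ne_zero]
  exact Finset.prod_ne_zero_iff.mpr fun i _ => hdiag i

section Interpolation

variable {n : ℕ} {q : ℂ} {τ : Fin n → ℂ}

theorem exists_interpolation (h : IsNonresonant q τ) (d : ℕ) (v : (Fin n → ℤ) → ℂ) :
    ∃ g, DegreeLE d g ∧ ∀ β, weight β ≤ d → evalAt (interpPoint q τ β) g = v β := by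
  classical
  have := Fintype.ofFinite {α : Fin n → ℤ // weight α ≤ d}
  let M : Matrix {α : Fin n → ℤ // weight α ≤ d} {α : Fin n → ℤ // weight α ≤ d} ℂ :=
    Matrix.of fun β α => evalAt (interpPoint q τ β.1) (newton q τ α.1)
  have hM : IsUnit M :=
    isUnit_of_blockTriangular (b := fun α => toColex (keySet α.1))
      (toColex.injective.comp (keySet_injective.comp Subtype.val_injective))
      (fun _ _ => evalAt_newton_eq_zero_of_keySet_lt h) fun α => evalAt_newton_self_ne_zero h α.1
  obtain ⟨c, hc⟩ := Matrix.mulVec_surjective_iff_isUnit.mpr hM fun β => v β.1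
  refine ⟨∑ α, c α • newton q τ α.1, mem_degreeLE.mp (sum_mem fun α _ =>
    Submodule.smul_mem _ _ (degreeLE_mono α.2 (newton_mem_degreeLE q τ α.1))), fun β hβ => ?_⟩
  rw [evalAt_sum, ← congrFun hc ⟨β, hβ⟩]
  simp only [evalAt_smul, Matrix.mulVec, dotProduct, M, Matrix.of_apply, mul_comm]

theorem eq_of_evalAt_interpPoint_eq (h : IsNonresonant q τ) {d : ℕ} {f g : Laurent n}
    (hf : DegreeLE d f) (hg : DegreeLE d g)
    (hfg : ∀ β, weight β ≤ d → evalAt (interpPoint q τ β) f = evalAt (interpPoint q τ β) g) :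
    f = g := by
  let coeffs : degreeLE n d →ₗ[ℂ] {α : Fin n → ℤ // weight α ≤ d} → ℂ :=
    LinearMap.pi fun α => Finsupp.lapply α.1 ∘ₗ
      (AddMonoidAlgebra.coeffLinearEquiv ℂ).toLinearMap ∘ₗ (degreeLE n d).subtype
  let values : degreeLE n d →ₗ[ℂ] {β : Fin n → ℤ // weight β ≤ d} → ℂ :=
    LinearMap.pi fun β => evalLinear (interpPoint q τ β.1) ∘ₗ (degreeLE n d).subtype
  have hcoeffs : Function.Injective coeffs := by
    intro f g hfg
    refine Subtype.ext (AddMonoidAlgebra.ext (Finsupp.ext fun α => ?_))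
    by_cases hα : weight α ≤ d
    · exact congrFun hfg ⟨α, hα⟩
    · rw [not_imp_comm.mp (mem_degreeLE.mp f.2 α) hα, not_imp_comm.mp (mem_degreeLE.mp g.2 α) hα]
  have hvalues : Function.Surjective values := by
    classical
    intro v
    obtain ⟨g, hg, hgv⟩ := exists_interpolation h d (Function.extend Subtype.val v 0)
    exact ⟨⟨g, mem_degreeLE.mpr hg⟩, funext fun β =>
      (hgv β.1 β.2).trans (Subtype.val_injective.extend_apply v 0 β)⟩
  have hinj := OrzechProperty.injective_of_surjective_of_injective coeffs values hcoeffs hvalues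
  have heq := @hinj ⟨f, mem_degreeLE.mpr hf⟩ ⟨g, mem_degreeLE.mpr hg⟩
    (funext fun β => hfg β.1 β.2)
  exact congrArg Subtype.val heq

theorem existsUnique_isNonsymInterp (h : IsNonresonant q τ) (α : Fin n → ℤ) :
    ∃! g, IsNonsymInterp q τ α g := by
  classical
  obtain ⟨g, hg, hgv⟩ := exists_interpolation h (weight α) (Pi.single α 1)
  refine ⟨g, ⟨hg, by rw [hgv α le_rfl, Pi.single_eq_same],
    fun β hβ hne => by rw [hgv β hβ, Pi.single_eq_of_ne hne]⟩, fun g' ⟨hdeg, hone, hzero⟩ => ?_⟩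
  refine eq_of_evalAt_interpPoint_eq h hdeg hg fun β hβ => ?_
  rw [hgv β hβ]
  by_cases hne : β = α
  · rw [hne, hone, Pi.single_eq_same]
  · rw [hzero β hβ hne, Pi.single_eq_of_ne hne]

theorem isNonsymInterp_nonsymInterp (h : IsNonresonant q τ) (α : Fin n → ℤ) :
    IsNonsymInterp q τ α (nonsymInterp q τ α) :=
  Classical.epsilon_spec (existsUnique_isNonsymInterp h α).exists

end Interpolation

/-! ## Symmetric Laurent polynomials -/

section Symmetric

variable {n : ℕ} {q : ℂ} {τ : Fin n → ℂ}

theorem weight_smul (w : WeylB n) (α : Fin n → ℤ) : weight (w • α) = weight α := by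
  simp only [weight, weyl_smul_apply, Int.natAbs_mul, Int.units_natAbs, one_mul]
  exact Equiv.sum_comp w.right.symm fun i => (α i).natAbs

theorem weight_of_mem_orbit {α β : Fin n → ℤ} (h : β ∈ MulAction.orbit (WeylB n) α) :
    weight β = weight α := by
  obtain ⟨w, rfl⟩ := h
  exact weight_smul w α

theorem mem_orbitFinset {α β : Fin n → ℤ} :
    β ∈ orbitFinset α ↔ β ∈ MulAction.orbit (WeylB n) α :=
  Set.Finite.mem_toFinset _

theorem mem_orbitFinset_iff_domRep_eq {lam β : Fin n → ℤ} (hlam : IsPartition lam) :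
    β ∈ orbitFinset lam ↔ domRep β = lam := by
  rw [mem_orbitFinset, MulAction.mem_orbit_symm]
  refine ⟨fun h => (eq_domRep_of_mem_orbit β lam hlam h).symm, ?_⟩
  rintro rfl
  exact domRep_mem_orbit β

theorem domRep_of_isPartition {μ : Fin n → ℤ} (hμ : IsPartition μ) : domRep μ = μ :=
  (eq_domRep_of_mem_orbit μ μ hμ (MulAction.mem_orbit_self μ)).symm

/-- The signed permutation that sorts the entries of `α` by `π_α` and makes them nonnegative, so
that it sends `α` to `α⁺`. -/
def domElt (α : Fin n → ℤ) : WeylB n := ⟨fun j => sgn (α (sortPerm α j)), (sortPerm α).symm⟩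

theorem monomialAt_interpPoint (q : ℂ) (τ : Fin n → ℂ) (α γ : Fin n → ℤ) :
    monomialAt (interpPoint q τ α) γ = monomialAt (interpPoint q τ (domRep α)) (domElt α • γ) := by
  rw [monomialAt, ← Equiv.prod_comp (sortPerm α)]
  refine Finset.prod_congr rfl fun j _ => ?_
  rw [interpPoint_of_isPartition q τ (isPartition_domRep α), interpPoint_apply, ← zpow_mul,
    weyl_smul_apply, Equiv.symm_apply_apply, domRep, Int.abs_eq_natAbs, zpow_natCast]
  rfl

theorem evalAt_interpPoint_of_isSymmetric {f : Laurent n} (hf : IsSymmetric f)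
    (q : ℂ) (τ : Fin n → ℂ) (α : Fin n → ℤ) :
    evalAt (interpPoint q τ α) f = evalAt (interpPoint q τ (domRep α)) f := by
  conv_rhs => rw [← hf (domElt α), evalAt_mapDomain]
  simp only [evalAt, monomialAt_interpPoint q τ α]

theorem eq_of_isSymmetric (h : IsNonresonant q τ) {d : ℕ} {f g : Laurent n} (hf : DegreeLE d f)
    (hg : DegreeLE d g) (hfs : IsSymmetric f) (hgs : IsSymmetric g)
    (hfg : ∀ μ, IsPartition μ → weight μ ≤ d →
      evalAt (interpPoint q τ μ) f = evalAt (interpPoint q τ μ) g) : f = g := by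
  refine eq_of_evalAt_interpPoint_eq h hf hg fun β hβ => ?_
  rw [evalAt_interpPoint_of_isSymmetric hfs, evalAt_interpPoint_of_isSymmetric hgs]
  exact hfg _ (isPartition_domRep β) ((weight_of_mem_orbit (domRep_mem_orbit β)).trans_le hβ)

/-- The space of symmetric Laurent polynomials. -/
def symmetricSubmodule (n : ℕ) : Submodule ℂ (Laurent n) where
  carrier := {f | IsSymmetric f}
  zero_mem' := fun _ => AddMonoidAlgebra.mapDomain_zero _
  add_mem' := fun hf hg w =>
    (AddMonoidAlgebra.mapDomain_add _ _ _).trans (congrArg₂ (· + ·) (hf w) (hg w))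
  smul_mem' := fun c f hf w =>
    (map_smul (AddMonoidAlgebra.mapDomainLinearMap ℂ ℂ _) c f).trans (congrArg (c • ·) (hf w))

/-- The sum of the monomials in the orbit of `α`. Those of the partitions of weight at most `d` span
the space in which the symmetric interpolation problem of degree `d` is solved. -/
def orbitSum (α : Fin n → ℤ) : Laurent n :=
  ∑ β ∈ orbitFinset α, AddMonoidAlgebra.single β 1

theorem isSymmetric_orbitSum (α : Fin n → ℤ) : IsSymmetric (orbitSum α) := by
  intro w
  have hmap : AddMonoidAlgebra.mapDomain (fun β : Fin n → ℤ => w • β) (orbitSum α) =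
      ∑ β ∈ orbitFinset α, AddMonoidAlgebra.single (w • β) 1 :=
    (map_sum (AddMonoidAlgebra.mapDomainLinearMap ℂ ℂ _) _ _).trans
      (Finset.sum_congr rfl fun β _ => AddMonoidAlgebra.mapDomainLinearMap_single ..)
  rw [hmap]
  refine Finset.sum_equiv (MulAction.toPerm w) (fun β => ?_) fun β _ => rfl
  rw [mem_orbitFinset, mem_orbitFinset, MulAction.toPerm_apply, ← MulAction.orbit_eq_iff,
    ← MulAction.orbit_eq_iff, MulAction.orbit_smul]

theorem orbitSum_mem_degreeLE (α : Fin n → ℤ) : orbitSum α ∈ degreeLE n (weight α) :=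
  sum_mem fun β hβ =>
    weight_of_mem_orbit (mem_orbitFinset.mp hβ) ▸ single_mem_degreeLE β 1

theorem coeff_orbitSum {lam μ : Fin n → ℤ} (hlam : IsPartition lam) (hμ : IsPartition μ) :
    (orbitSum lam).coeff μ = if μ = lam then 1 else 0 := by
  rw [orbitSum, AddMonoidAlgebra.coeff_sum, Finsupp.finsetSum_apply]
  simp only [AddMonoidAlgebra.coeff_single, Finsupp.single_apply, Finset.sum_ite_eq',
    mem_orbitFinset_iff_domRep_eq hlam, domRep_of_isPartition hμ]

theorem linearIndependent_orbitSum :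
    LinearIndependent ℂ fun lam : {μ : Fin n → ℤ // IsPartition μ} => orbitSum lam.1 := by
  refine LinearIndependent.of_pairwise_dual_eq_zero_one _
    (fun μ => Finsupp.lapply μ.1 ∘ₗ (AddMonoidAlgebra.coeffLinearEquiv ℂ).toLinearMap)
    (fun μ lam hne => ?_) fun lam => ?_
  · exact (coeff_orbitSum lam.2 μ.2).trans (if_neg (Subtype.coe_ne_coe.mpr hne))
  · exact (coeff_orbitSum lam.2 lam.2).trans (if_pos rfl)

theorem exists_symmetric_interpolation (h : IsNonresonant q τ) (d : ℕ) (v : (Fin n → ℤ) → ℂ) :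
    ∃ f, IsSymmetric f ∧ DegreeLE d f ∧
      ∀ μ, IsPartition μ → weight μ ≤ d → evalAt (interpPoint q τ μ) f = v μ := by
  let P := {μ : Fin n → ℤ // IsPartition μ ∧ weight μ ≤ d}
  have : Finite P := Finite.of_injective (Subtype.map id fun _ hμ => hμ.2)
    (Subtype.map_injective (q := fun μ => weight μ ≤ d) _ Function.injective_id)
  have := Fintype.ofFinite P
  let comb : (P → ℂ) →ₗ[ℂ] Laurent n := Fintype.linearCombination ℂ fun lam => orbitSum lam.1
  let values : Laurent n →ₗ[ℂ] P → ℂ := LinearMap.pi fun μ => evalLinear (interpPoint q τ μ.1)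
  have hsym (c : P → ℂ) : comb c ∈ symmetricSubmodule n :=
    sum_mem fun lam _ => Submodule.smul_mem _ _ (isSymmetric_orbitSum lam.1)
  have hdeg (c : P → ℂ) : comb c ∈ degreeLE n d :=
    sum_mem fun lam _ => Submodule.smul_mem _ _
      (degreeLE_mono lam.2.2 (orbitSum_mem_degreeLE lam.1))
  have hcomb : Function.Injective comb :=
    linearIndependent_iff_injective_fintypeLinearCombination.mp <| linearIndependent_orbitSum.comp
      (Subtype.map id fun _ hμ => hμ.1) (Subtype.map_injective _ Function.injective_id)
  have hinj : Function.Injective (values ∘ₗ comb) := fun c c' hcc' =>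
    hcomb <| eq_of_isSymmetric h (mem_degreeLE.mp (hdeg c)) (mem_degreeLE.mp (hdeg c'))
      (hsym c) (hsym c') fun μ hμ hw => congrFun hcc' ⟨μ, hμ, hw⟩
  obtain ⟨c, hc⟩ := LinearMap.injective_iff_surjective.mp hinj fun μ => v μ.1
  exact ⟨comb c, hsym c, mem_degreeLE.mp (hdeg c), fun μ hμ hw => congrFun hc ⟨μ, hμ, hw⟩⟩

theorem existsUnique_isSymInterp (h : IsNonresonant q τ) {lam : Fin n → ℤ}
    (hlam : IsPartition lam) : ∃! f, IsSymInterp q τ lam f := by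
  classical
  obtain ⟨f, hfs, hf, hfv⟩ := exists_symmetric_interpolation h (weight lam) (Pi.single lam 1)
  refine ⟨f, ⟨hfs, hf, by rw [hfv lam hlam le_rfl, Pi.single_eq_same],
    fun μ hμ hw hne => by rw [hfv μ hμ hw, Pi.single_eq_of_ne hne]⟩,
    fun f' ⟨hsym, hdeg, hone, hzero⟩ => ?_⟩
  refine eq_of_isSymmetric h hdeg hf hsym hfs fun μ hμ hw => ?_
  rw [hfv μ hμ hw]
  by_cases hne : μ = lam
  · rw [hne, hone, Pi.single_eq_same]
  · rw [hzero μ hμ hw hne, Pi.single_eq_of_ne hne]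

theorem isSymInterp_symInterp (h : IsNonresonant q τ) {lam : Fin n → ℤ} (hlam : IsPartition lam) :
    IsSymInterp q τ lam (symInterp q τ lam) :=
  Classical.epsilon_spec (existsUnique_isSymInterp h hlam).exists

theorem eq_smul_symInterp (h : IsNonresonant q τ) {lam : Fin n → ℤ} (hlam : IsPartition lam)
    {f : Laurent n} (hfs : IsSymmetric f) (hf : DegreeLE (weight lam) f)
    (hzero : ∀ μ, IsPartition μ → weight μ ≤ weight lam → μ ≠ lam →
      evalAt (interpPoint q τ μ) f = 0) :
    f = evalAt (interpPoint q τ lam) f • symInterp q τ lam := by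
  obtain ⟨hRs, hR, hRone, hRzero⟩ := isSymInterp_symInterp h hlam
  refine eq_of_isSymmetric h hf (mem_degreeLE.mp (Submodule.smul_mem _ _ (mem_degreeLE.mpr hR)))
    hfs ((symmetricSubmodule n).smul_mem _ hRs) fun μ hμ hw => ?_
  rw [evalAt_smul]
  by_cases hne : μ = lam
  · rw [hne, hRone, mul_one]
  · rw [hzero μ hμ hw hne, hRzero μ hμ hw hne, mul_zero]

theorem symInterp_eq_sum (h : IsNonresonant q τ) {lam : Fin n → ℤ} (hlam : IsPartition lam) :
    symInterp q τ lam = ∑ β ∈ orbitFinset lam, nonsymInterp q τ β := by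
  obtain ⟨hRs, hR, hRone, hRzero⟩ := isSymInterp_symInterp h hlam
  have hG := isNonsymInterp_nonsymInterp h
  have hweight {β} (hβ : β ∈ orbitFinset lam) : weight β = weight lam :=
    weight_of_mem_orbit (mem_orbitFinset.mp hβ)
  have hsum : ∑ β ∈ orbitFinset lam, nonsymInterp q τ β ∈ degreeLE n (weight lam) :=
    sum_mem fun β hβ => hweight hβ ▸ mem_degreeLE.mpr (hG β).1
  refine eq_of_evalAt_interpPoint_eq h hR (mem_degreeLE.mp hsum) fun α hα => ?_
  rw [evalAt_interpPoint_of_isSymmetric hRs, evalAt_sum]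
  have hGzero {β} (hβ : β ∈ orbitFinset lam) (hne : α ≠ β) :
      evalAt (interpPoint q τ α) (nonsymInterp q τ β) = 0 :=
    (hG β).2.2 α (hα.trans (hweight hβ).ge) hne
  by_cases hαlam : domRep α = lam
  · have hmem := (mem_orbitFinset_iff_domRep_eq hlam).mpr hαlam
    rw [hαlam, hRone, Finset.sum_eq_single_of_mem α hmem fun β hβ hne => hGzero hβ hne.symm,
      (hG α).2.1]
  · have hmem := mt (mem_orbitFinset_iff_domRep_eq hlam).mp hαlam
    rw [hRzero _ (isPartition_domRep α)
      ((weight_of_mem_orbit (domRep_mem_orbit α)).trans_le hα) hαlam,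
      Finset.sum_eq_zero fun β hβ => hGzero hβ (ne_of_mem_of_not_mem hβ hmem).symm]

end Symmetric

section PrincipalSpecialization

variable {n : ℕ} {q s t : ℂ} {lam : Fin n → ℤ}

theorem evalAt_interpPoint_rescale_inv (q : ℂ) {τ : Fin n → ℂ} (hτ : ∀ i, τ i ≠ 0)
    {μ : Fin n → ℤ} (hμ : IsPartition μ) (P : Laurent n) :
    evalAt (interpPoint q τ μ) (rescale (fun i => (τ i)⁻¹) P) = evalAt (fun i => q ^ μ i) P := by
  rw [evalAt_rescale]
  congr 1
  funext i
  rw [interpPoint_of_isPartition q τ hμ, mul_comm (q ^ μ i), inv_mul_cancel_left₀ (hτ i)]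

theorem exists_isOkounkov (h : IsNonresonant q (principalSpec n s t)) (hlam : IsPartition lam) :
    ∃ P, IsOkounkov q s t lam P := by
  obtain ⟨hRs, hR, hRone, hRzero⟩ := isSymInterp_symInterp h hlam
  have hcancel := rescale_inv_rescale h.param_ne_zero (symInterp q (principalSpec n s t) lam)
  have heval {μ} (hμ : IsPartition μ) := hcancel ▸ (evalAt_interpPoint_rescale_inv q
    h.param_ne_zero hμ (rescale _ (symInterp q (principalSpec n s t) lam))).symm
  refine ⟨rescale (principalSpec n s t) (symInterp q (principalSpec n s t) lam), hR.rescale _,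
    by rwa [hcancel], ?_, fun μ hμ hw hne => ?_⟩
  · rw [heval hlam, hRone]
    exact one_ne_zero
  · rw [heval hμ, hRzero μ hμ hw hne]

theorem rescale_eq_smul_symInterp (h : IsNonresonant q (principalSpec n s t))
    (hlam : IsPartition lam) {P : Laurent n} (hP : IsOkounkov q s t lam P) :
    rescale (fun i => (principalSpec n s t i)⁻¹) P =
      evalAt (fun i => q ^ lam i) P • symInterp q (principalSpec n s t) lam := by
  obtain ⟨hdeg, hsym, _, hzero⟩ := hP
  have hresult := eq_smul_symInterp h hlam hsym (hdeg.rescale _) fun μ hμ hw hne => by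
    rw [evalAt_interpPoint_rescale_inv q h.param_ne_zero hμ, hzero μ hμ hw hne]
  rwa [evalAt_interpPoint_rescale_inv q h.param_ne_zero hlam] at hresult

end PrincipalSpecialization

end BCInterp

end

theorem mainTheorem2_general (n : ℕ) (q : ℂ) :
    (∀ τ : Fin n → ℂ, IsNonresonant q τ →
      (∀ lam : Fin n → ℤ, IsPartition lam → ∃! f, IsSymInterp q τ lam f) ∧
      (∀ α : Fin n → ℤ, ∃! g, IsNonsymInterp q τ α g) ∧
      (∀ lam : Fin n → ℤ, IsPartition lam → ∀ α : Fin n → ℤ,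
        evalAt (interpPoint q τ α) (symInterp q τ lam) =
          evalAt (interpPoint q τ (domRep α)) (symInterp q τ lam)) ∧
      (∀ lam : Fin n → ℤ, IsPartition lam →
        symInterp q τ lam = ∑ β ∈ orbitFinset lam, nonsymInterp q τ β)) ∧
    (∀ s t : ℂ, IsNonresonant q (principalSpec n s t) →
      ∀ lam : Fin n → ℤ, IsPartition lam →
        symInterp q (principalSpec n s t) lam =
          ∑ β ∈ orbitFinset lam, nonsymInterp q (principalSpec n s t) β ∧
        (∃ P, IsOkounkov q s t lam P) ∧
        ∀ P, IsOkounkov q s t lam P →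
          rescale (fun i => (principalSpec n s t i)⁻¹) P =
            evalAt (fun i => q ^ lam i) P •
              ∑ β ∈ orbitFinset lam, nonsymInterp q (principalSpec n s t) β) := by
  refine ⟨fun τ h => ⟨fun _ hlam => existsUnique_isSymInterp h hlam,
    existsUnique_isNonsymInterp h, fun _ hlam α =>
      evalAt_interpPoint_of_isSymmetric (isSymInterp_symInterp h hlam).1 q τ α,
    fun _ hlam => symInterp_eq_sum h hlam⟩, fun s t h lam hlam => ?_⟩
  have hsum := symInterp_eq_sum h hlam
  exact ⟨hsum, exists_isOkounkov h hlam, fun P hP =>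
    hsum ▸ rescale_eq_smul_symInterp h hlam hP⟩

theorem mainTheorem2 (n : ℕ) (hn : 0 < n) (q : ℂ) (hq0 : 0 < ‖q‖) (hq1 : ‖q‖ < 1) :
    (∀ τ ∈ paramSet n,
      (∀ lam : Fin n → ℤ, IsPartition lam → ∃! f, IsSymInterp q τ lam f) ∧
      (∀ α : Fin n → ℤ, ∃! g, IsNonsymInterp q τ α g) ∧
      (∀ lam : Fin n → ℤ, IsPartition lam → ∀ α : Fin n → ℤ,
        evalAt (interpPoint q τ α) (symInterp q τ lam) =
          evalAt (interpPoint q τ (domRep α)) (symInterp q τ lam)) ∧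
      (∀ lam : Fin n → ℤ, IsPartition lam →
        symInterp q τ lam = ∑ β ∈ orbitFinset lam, nonsymInterp q τ β)) ∧
    (∀ s t : ℂ, 0 < ‖s‖ → ‖s‖ < 1 → (1 < n → 0 < ‖t‖ ∧ ‖t‖ < 1) →
      principalSpec n s t ∈ paramSet n ∧
      ∀ lam : Fin n → ℤ, IsPartition lam →
        symInterp q (principalSpec n s t) lam =
          ∑ β ∈ orbitFinset lam, nonsymInterp q (principalSpec n s t) β ∧
        (∃ P, IsOkounkov q s t lam P) ∧
        ∀ P, IsOkounkov q s t lam P →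
          rescale (fun i => (principalSpec n s t i)⁻¹) P =
            evalAt (fun i => q ^ lam i) P •
              ∑ β ∈ orbitFinset lam, nonsymInterp q (principalSpec n s t) β) := by
  refine ⟨fun τ hτ => (mainTheorem2_general n q).1 τ (isNonresonant_of_mem_paramSet hq0 hq1 hτ),
    fun s t hs0 hs1 ht => ?_⟩
  have hτ := principalSpec_mem_paramSet hs0 hs1 ht
  exact ⟨hτ, (mainTheorem2_general n q).2 s t (isNonresonant_of_mem_paramSet hq0 hq1 hτ)⟩
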